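/- Let $n,k\ge 0$ be integers. For $\lambda=(\lambda_1,\dots,\lambda_n)\in\mathbb R^n$ let $S_j(\lambda)$ be the $j$-th elementary symmetric polynomial of $\lambda_1,\dots,\lambda_n$ (with $S_0=1$ and $S_j=0$ for $j>n$), let $Q_k=S_{k+1}/S_k$, and let $\Gamma_{k+1}=\{\lambda\in\mathbb R^n : S_i(\lambda)>0 \text{ for } i=1,\dots,k+1\}$. For $u\in C^3(\mathbb R^n)$ let $\lambda(x)$ denote the principal curvatures of the graph of $u$ at $(x,u(x))$ with respect to the upward unit normal, that is, the eigenvalues, with multiplicity, of $g^{-1}h$, where $g_{ij}=\delta_{ij}+u_iu_j$, $h_{ij}=u_{ij}/\sqrt{1+|Du|^2}$, and $u_i,u_{ij}$ are the first and second partial derivatives of $u$ at $x$. Then there is no function $u\in C^3(\mathbb R^n)$ that satisfies the graphical $Q_k$-translator equation $$Q_k(\lambda(x))=\frac{1}{\sqrt{1+|Du(x)|^2}}\qquad\text{for all } x\in\mathbb R^n$$ together with 1. $\lambda(x)\in\Gamma_{k+1}$ for all $x\in\mathbb R^n$, and 2. $u(x)=o(|x|)$ as $|x|\to\infty$. -/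

import Mathlib

open Asymptotics Bornology

namespace QkTranslator

noncomputable section

/-- The `j`-th elementary symmetric polynomial `S_j`, evaluated at an unordered tuple of real
numbers: the sum of all products of `j` entries. In particular `S_0 = 1`, and `S_j = 0` when `j`
exceeds the number of entries. -/
def S (j : ℕ) (l : Multiset ℝ) : ℝ := l.esymm j

/-- The curvature quotient `Q_k = S_{k+1} / S_k`. -/
def Q (k : ℕ) (l : Multiset ℝ) : ℝ := S (k + 1) l / S k l

/-- The cone `Γ_m`: all `l` with `S_i(l) > 0` for `1 ≤ i ≤ m`. -/
def Gam (m : ℕ) : Set (Multiset ℝ) := {l | ∀ i, 1 ≤ i → i ≤ m → 0 < S i l}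

variable {n : ℕ}

/-- The partial derivative `∂_i f` at `x`. -/
def pd (i : Fin n) (f : EuclideanSpace ℝ (Fin n) → ℝ) (x : EuclideanSpace ℝ (Fin n)) : ℝ :=
  fderiv ℝ f x (EuclideanSpace.single i 1)

/-- The gradient vector `Du = (∂_1 u, …, ∂_n u)` at `x`. -/
def grad (u : EuclideanSpace ℝ (Fin n) → ℝ) (x : EuclideanSpace ℝ (Fin n)) : Fin n → ℝ :=
  fun i => pd i u x

/-- The matrix `D²u` of second partial derivatives at `x`. -/
def hess (u : EuclideanSpace ℝ (Fin n) → ℝ) (x : EuclideanSpace ℝ (Fin n)) :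
    Matrix (Fin n) (Fin n) ℝ :=
  Matrix.of fun i j => pd j (pd i u) x

/-- `w = √(1 + |Du|²)`. -/
def w (u : EuclideanSpace ℝ (Fin n) → ℝ) (x : EuclideanSpace ℝ (Fin n)) : ℝ :=
  Real.sqrt (1 + ∑ i, grad u x i ^ 2)

/-- The first fundamental form `g_ij = δ_ij + u_i u_j` of the graph of `u`, in the
parametrization `x ↦ (x, u x)`. -/
def firstForm (u : EuclideanSpace ℝ (Fin n) → ℝ) (x : EuclideanSpace ℝ (Fin n)) :
    Matrix (Fin n) (Fin n) ℝ :=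
  1 + Matrix.vecMulVec (grad u x) (grad u x)

/-- The second fundamental form `h_ij = u_ij / w` of the graph of `u`, with respect to the
upward unit normal `ν = (-Du, 1) / w`. -/
def secondForm (u : EuclideanSpace ℝ (Fin n) → ℝ) (x : EuclideanSpace ℝ (Fin n)) :
    Matrix (Fin n) (Fin n) ℝ :=
  (w u x)⁻¹ • hess u x

/-- The Weingarten map `g⁻¹ h` of the graph of `u`. -/
def weingarten (u : EuclideanSpace ℝ (Fin n) → ℝ) (x : EuclideanSpace ℝ (Fin n)) :
    Matrix (Fin n) (Fin n) ℝ :=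
  (firstForm u x)⁻¹ * secondForm u x

/-- The principal curvatures of the graph of `u` at `(x, u x)`: the eigenvalues of the Weingarten
map, listed with multiplicity. -/
def principalCurvatures (u : EuclideanSpace ℝ (Fin n) → ℝ) (x : EuclideanSpace ℝ (Fin n)) :
    Multiset ℝ :=
  (weingarten u x).charpoly.roots

/-- The graphical `Q_k`-translator equation `Q_k(Du, D²u) = 1 / √(1 + |Du|²)` on all of `ℝⁿ`,
with `Q_k` evaluated at the principal curvatures of the graph. -/
def IsTranslator (k : ℕ) (u : EuclideanSpace ℝ (Fin n) → ℝ) : Prop :=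
  ∀ x, Q k (principalCurvatures u x) = 1 / w u x

/-- The symmetrized Weingarten matrix
`A_ij = w⁻¹ (u_ij - u_i u_k u_kj / (w (1 + w)) - u_j u_k u_ki / (w (1 + w))
  + u_i u_j u_k u_l u_kl / (w² (1 + w)²))`, with summation over repeated indices. -/
def symWeingarten (u : EuclideanSpace ℝ (Fin n) → ℝ) (x : EuclideanSpace ℝ (Fin n)) :
    Matrix (Fin n) (Fin n) ℝ :=
  Matrix.of fun i j => (w u x)⁻¹ * (hess u x i j
    - (∑ k, grad u x i * grad u x k * hess u x k j) / (w u x * (1 + w u x))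
    - (∑ k, grad u x j * grad u x k * hess u x k i) / (w u x * (1 + w u x))
    + (∑ k, ∑ l, grad u x i * grad u x j * grad u x k * grad u x l * hess u x k l)
        / (w u x ^ 2 * (1 + w u x) ^ 2))

lemma hess_symm {u : EuclideanSpace ℝ (Fin n) → ℝ} (hu : ContDiff ℝ 2 u)
    (x : EuclideanSpace ℝ (Fin n)) (i j : Fin n) : hess u x i j = hess u x j i := by
  have hd : DifferentiableAt ℝ (fderiv ℝ u) x :=
    ((hu.fderiv_right (m := 1) (by norm_num)).differentiable (by norm_num)) x
  have key : ∀ a b : Fin n, hess u x a b =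
      fderiv ℝ (fderiv ℝ u) x (EuclideanSpace.single b 1) (EuclideanSpace.single a 1) := by
    intro a b
    simp only [hess, pd, Matrix.of_apply]
    rw [show pd a u = fun y =>
      (fderiv ℝ u y) ((fun _ => EuclideanSpace.single a (1 : ℝ)) y) from rfl,
      fderiv_clm_apply hd (differentiableAt_const _)]
    simp
  rw [key, key]
  exact (hu.contDiffAt.isSymmSndFDerivAt (by simp)) _ _

/-- For a function of class `C²`, the matrix `A` is symmetric. -/
lemma symWeingarten_isHermitian {u : EuclideanSpace ℝ (Fin n) → ℝ} (hu : ContDiff ℝ 2 u)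
    (x : EuclideanSpace ℝ (Fin n)) : (symWeingarten u x).IsHermitian := by
  ext i j
  simp only [Matrix.conjTranspose_apply, star_trivial, symWeingarten, Matrix.of_apply]
  rw [hess_symm hu x j i]
  have : ∀ k l, grad u x j * grad u x i * grad u x k * grad u x l * hess u x k l
      = grad u x i * grad u x j * grad u x k * grad u x l * hess u x k l := by
    intros; ring
  simp only [this]
  ring

/-- The principal curvatures are the eigenvalues of the symmetric matrix `A`. -/
lemma principalCurvatures_eq {u : EuclideanSpace ℝ (Fin n) → ℝ} (hu : ContDiff ℝ 2 u)
    (x : EuclideanSpace ℝ (Fin n)) :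
    principalCurvatures u x = (symWeingarten u x).charpoly.roots := by
  set p := grad u x with hp
  set W := w u x with hW
  have hs : 0 ≤ ∑ i, p i ^ 2 := Finset.sum_nonneg fun i _ => sq_nonneg _
  have hWpos : 0 < W := Real.sqrt_pos.mpr (by positivity)
  have hW2 : p ⬝ᵥ p = W ^ 2 - 1 := by
    rw [hW, w, Real.sq_sqrt (by positivity)]
    simp [dotProduct, hp, pow_two]
  set c : ℝ := (W * (1 + W))⁻¹ with hc
  have hc' : c * (W * (1 + W)) = 1 := inv_mul_cancel₀ (by positivity)
  set P : Matrix (Fin n) (Fin n) ℝ := 1 - c • Matrix.vecMulVec p p with hP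
  have hvv : Matrix.vecMulVec p p * Matrix.vecMulVec p p = (W ^ 2 - 1) • Matrix.vecMulVec p p := by
    rw [Matrix.vecMulVec_mul_vecMulVec, hW2]
    ext i j; simp [Matrix.vecMulVec_apply]; ring
  have hgP : (P * P) * firstForm u x = 1 := by
    have hcc : -c + -c + c * c * (W ^ 2 - 1) + 1
        + (-c + -c + c * c * (W ^ 2 - 1)) * (W ^ 2 - 1) = 0 := by
      rw [hc]; field_simp; ring
    have hPP : P * P = 1 + (-c + -c + c * c * (W ^ 2 - 1)) • Matrix.vecMulVec p p := by
      rw [hP, sub_mul, mul_sub, mul_sub, smul_mul_smul_comm, hvv]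
      simp only [mul_one, one_mul]
      module
    rw [hPP, firstForm, ← hp, add_mul, mul_add, mul_add, smul_mul_assoc, smul_mul_assoc, hvv]
    simp only [mul_one, one_mul]
    rw [smul_smul, add_assoc,
      show ∀ (a b : ℝ) (X : Matrix (Fin n) (Fin n) ℝ), X + (a • X + b • X) = (a + 1 + b) • X by
        intros; module, hcc]
    simp
  have hA : symWeingarten u x = P * secondForm u x * P := by
    have h1 : P * secondForm u x * P = W⁻¹ • (hess u x
        - c • (Matrix.vecMulVec p p * hess u x) - c • (hess u x * Matrix.vecMulVec p p)
        + (c * c) • (Matrix.vecMulVec p p * hess u x * Matrix.vecMulVec p p)) := by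
      rw [secondForm, ← hW, mul_smul_comm, smul_mul_assoc, hP, sub_mul, mul_sub, sub_mul]
      simp only [mul_one, one_mul, smul_mul_assoc, mul_smul_comm, sub_mul]
      clear_value c W
      module
    rw [h1]
    ext i j
    simp only [symWeingarten, Matrix.of_apply, Matrix.smul_apply, Matrix.add_apply,
      Matrix.sub_apply, smul_eq_mul, Matrix.mul_apply, Matrix.vecMulVec_apply, ← hW, ← hp]
    congr 2
    · congr 1
      · rw [div_eq_inv_mul]
      · rw [div_eq_inv_mul]
        congr 1
        refine Finset.sum_congr rfl fun k _ => ?_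
        rw [hess_symm hu x k i]; ring
    · rw [div_eq_inv_mul]
      congr 1
      · rw [hc, ← mul_pow, pow_two, mul_inv]
      · rw [Finset.sum_comm]
        refine Finset.sum_congr rfl fun l _ => ?_
        rw [Finset.sum_mul]
        refine Finset.sum_congr rfl fun k _ => ?_
        ring
  rw [principalCurvatures, weingarten, Matrix.inv_eq_left_inv hgP, hA, Matrix.mul_assoc,
    Matrix.charpoly_mul_comm]

/-- A graph of class `C²` has exactly `n` principal curvatures, counted with multiplicity. -/
lemma card_principalCurvatures {u : EuclideanSpace ℝ (Fin n) → ℝ} (hu : ContDiff ℝ 2 u)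
    (x : EuclideanSpace ℝ (Fin n)) : (principalCurvatures u x).card = n := by
  rw [principalCurvatures_eq hu, (symWeingarten_isHermitian hu x).roots_charpoly_eq_eigenvalues]
  simp

end

end QkTranslator

/-! On `Gam k`, Newton's inequalities make the quotients `S (j + 1) / S j` decrease in `j` up to `j
= k`, so `Q k ≤ S 1`, the mean curvature (`Q_le_sum`). A translator therefore has mean curvature at
least `1 / w` everywhere. Sublinear growth makes `u - ε √(1 + |x|²)` attain a maximum, and there
`D²u ≤ ε` (`exists_hess_le`). Since `g⁻¹ ≤ 1`, the mean curvature at that point is at most `ε n /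
w`, without any gradient estimate (`trace_weingarten_le`). The factor `1 / w` cancels, and `ε n < 1`
is a contradiction. -/

open Filter Topology

/-- The necessary second-order condition at a local maximum. -/
lemma IsLocalMax.deriv_deriv_nonpos {f : ℝ → ℝ} {a : ℝ} (h : IsLocalMax f a)
    (hc : ContinuousAt f a) : deriv (deriv f) a ≤ 0 := by
  by_contra! hpos
  have hmin := isLocalMin_of_deriv_deriv_pos hpos h.deriv_eq_zero hc
  -- A point that is both a local maximum and a local minimum makes `f` locally constant, so its
  -- second derivative vanishes.
  have heq : f =ᶠ[𝓝 a] fun _ => f a := by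
    filter_upwards [h, hmin] with y h1 h2 using le_antisymm h1 h2
  have := heq.deriv.deriv_eq
  simp at this
  linarith

/-! ### Real-rooted polynomials -/

-- By Rolle, counting multiplicity, differentiation loses at most one real root, and the degree also
-- drops.
open Polynomial in
lemma Polynomial.Splits.real_derivative {p : ℝ[X]} (hp : p.Splits) : p.derivative.Splits := by
  rw [splits_iff_card_roots] at hp ⊢
  have h1 := card_roots_le_derivative p
  have h2 := card_roots' (derivative p)
  have h3 := natDegree_derivative_le p
  omega

open Polynomial in
lemma Polynomial.Splits.real_iterate_derivative {p : ℝ[X]} (hp : p.Splits) (m : ℕ) :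
    (derivative^[m] p).Splits := by
  induction m with
  | zero => exact hp
  | succ m ih => rw [Function.iterate_succ_apply']; exact ih.real_derivative

open Polynomial in
/-- Laguerre's inequality for real polynomials with only real roots. -/
lemma Polynomial.Splits.laguerre {p : ℝ[X]} (hp : p.Splits) (x : ℝ) :
    p.eval x * p.derivative.derivative.eval x ≤ p.derivative.eval x ^ 2 := by
  have key : ∀ s : Multiset ℝ, (s.map (X - C ·)).prod.eval x *
      (s.map (X - C ·)).prod.derivative.derivative.eval x ≤
      (s.map (X - C ·)).prod.derivative.eval x ^ 2 := by
    intro s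
    induction s using Multiset.induction with
    | empty => simp
    | cons a s ih =>
      simp only [Multiset.map_cons, Multiset.prod_cons, derivative_mul, derivative_add,
        derivative_sub, derivative_X, derivative_C, eval_add, eval_mul, eval_sub, eval_X, eval_C,
        sub_zero, one_mul]
      -- For `q = (X - a) s` one has `q'² - q q'' = s² + (x - a)² (s'² - s s'')`.
      nlinarith [mul_le_mul_of_nonneg_left ih (sq_nonneg (x - a)),
        sq_nonneg ((s.map (X - C ·)).prod.eval x)]
  rw [hp.eq_prod_roots]
  simp only [derivative_mul, derivative_C, zero_mul, zero_add, eval_mul, eval_C]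
  nlinarith [mul_le_mul_of_nonneg_left (key p.roots) (sq_nonneg p.leadingCoeff)]

-- Laguerre's inequality at `0` for the `m`-th derivative, whose Taylor data there are factorials
-- times coefficients of `p`. This gives the sharper factors `m + 2` and `m + 1`, which are then
-- dropped.
open Polynomial in
lemma Polynomial.Splits.coeff_mul_coeff_le {p : ℝ[X]} (hp : p.Splits) (m : ℕ) :
    p.coeff m * p.coeff (m + 2) ≤ p.coeff (m + 1) ^ 2 := by
  have h := (hp.real_iterate_derivative m).laguerre 0
  have hc : ∀ j, (derivative^[j] p).eval 0 = j.factorial * p.coeff j := by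
    intro j
    rw [← coeff_zero_eq_eval_zero, coeff_iterate_derivative]
    simp [Nat.descFactorial_self]
  rw [← Function.iterate_succ_apply' derivative, ← Function.iterate_succ_apply' derivative,
    hc, hc, hc] at h
  simp only [Nat.factorial_succ, Nat.succ_eq_add_one, Nat.cast_mul] at h
  have hf : (0 : ℝ) < (m.factorial : ℝ) ^ 2 := by positivity
  push_cast at h
  have h' : (m + 2 : ℝ) * (p.coeff m * p.coeff (m + 2)) ≤ (m + 1) * p.coeff (m + 1) ^ 2 := by
    have hm : (0 : ℝ) < m + 1 := by positivity
    refine le_of_mul_le_mul_left ?_ (mul_pos hf hm)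
    linear_combination h
  by_contra! hlt
  nlinarith [sq_nonneg (p.coeff (m + 1)), (Nat.cast_nonneg m : (0 : ℝ) ≤ m)]

/-! ### Newton's inequality and the bound of `Q k` by the mean curvature -/

namespace QkTranslator

/-- Newton's inequality, without its binomial factors. -/
lemma S_mul_S_le (l : Multiset ℝ) (j : ℕ) : S j l * S (j + 2) l ≤ S (j + 1) l ^ 2 := by
  unfold S
  by_cases hj : j + 2 ≤ l.card
  · have hs : (l.map fun r => Polynomial.X + Polynomial.C r).prod.Splits := by
      refine Polynomial.Splits.multisetProd fun q hq => ?_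
      obtain ⟨r, -, rfl⟩ := Multiset.mem_map.mp hq
      exact Polynomial.Splits.X_add_C r
    -- In `∏ (X + r)` the coefficient of `X ^ (card - i)` is `S i`, so the indices run backwards.
    have h := hs.coeff_mul_coeff_le (l.card - (j + 2))
    rw [l.prod_X_add_C_coeff (by omega), l.prod_X_add_C_coeff (by omega),
      l.prod_X_add_C_coeff (by omega)] at h
    rw [show l.card - (l.card - (j + 2)) = j + 2 by omega,
      show l.card - (l.card - (j + 2) + 2) = j by omega,
      show l.card - (l.card - (j + 2) + 1) = j + 1 by omega] at h
    linarith
  · rw [show l.esymm (j + 2) = 0 by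
      rw [Multiset.esymm, Multiset.powersetCard_eq_empty _ (by omega)]; simp]
    nlinarith [sq_nonneg (l.esymm (j + 1))]

@[simp] lemma S_zero (l : Multiset ℝ) : S 0 l = 1 := by simp [S, Multiset.esymm]

lemma S_one (l : Multiset ℝ) : S 1 l = l.sum := by
  simp [S, Multiset.esymm, Multiset.powersetCard_one]

lemma S_succ_le {k : ℕ} {l : Multiset ℝ} (hl : l ∈ Gam k) : S (k + 1) l ≤ S 1 l * S k l := by
  induction k with
  | zero => simp
  | succ k ih =>
    have h1 := ih fun i hi hik => hl i hi (by omega)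
    have h0 : 0 < S k l := by
      rcases Nat.eq_zero_or_pos k with rfl | hk
      · simp
      · exact hl k hk (by omega)
    have h2 : 0 < S (k + 1) l := hl (k + 1) (by omega) le_rfl
    refine le_of_mul_le_mul_left ?_ h0
    -- `S k * S (k + 2) ≤ S (k + 1) ^ 2 ≤ S (k + 1) * (S 1 * S k)`, and `S k > 0` cancels.
    nlinarith [S_mul_S_le l k, mul_le_mul_of_nonneg_left h1 h2.le]

lemma Q_le_sum {k : ℕ} {l : Multiset ℝ} (hl : l ∈ Gam k) : Q k l ≤ l.sum := by
  have h0 : 0 < S k l := by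
    rcases Nat.eq_zero_or_pos k with rfl | hk
    · simp
    · exact hl k hk le_rfl
  rw [Q, div_le_iff₀ h0, ← S_one]
  exact S_succ_le hl

/-! ### Mean curvature of a graph -/

variable {n : ℕ}

lemma sum_principalCurvatures {u : EuclideanSpace ℝ (Fin n) → ℝ} (hu : ContDiff ℝ 2 u)
    (x : EuclideanSpace ℝ (Fin n)) : (principalCurvatures u x).sum = (weingarten u x).trace := by
  refine (Matrix.trace_eq_sum_roots_charpoly_of_splits ?_).symm
  rw [Polynomial.splits_iff_card_roots, Matrix.charpoly_natDegree_eq_dim, Fintype.card_fin]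
  exact card_principalCurvatures hu x

lemma w_pos (u : EuclideanSpace ℝ (Fin n) → ℝ) (x : EuclideanSpace ℝ (Fin n)) : 0 < w u x :=
  Real.sqrt_pos.mpr (by positivity)

lemma grad_dotProduct_grad (u : EuclideanSpace ℝ (Fin n) → ℝ) (x : EuclideanSpace ℝ (Fin n)) :
    grad u x ⬝ᵥ grad u x = w u x ^ 2 - 1 := by
  have hs : 0 ≤ ∑ i, grad u x i ^ 2 := Finset.sum_nonneg fun i _ => sq_nonneg _
  rw [w, Real.sq_sqrt (by positivity)]
  simp [dotProduct, pow_two]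

/-- The Sherman–Morrison formula, with `1 + |Du|² = w²`. -/
lemma firstForm_inv (u : EuclideanSpace ℝ (Fin n) → ℝ) (x : EuclideanSpace ℝ (Fin n)) :
    (firstForm u x)⁻¹ = 1 - (w u x ^ 2)⁻¹ • Matrix.vecMulVec (grad u x) (grad u x) := by
  have hw := w_pos u x
  refine Matrix.inv_eq_left_inv ?_
  have hvv : Matrix.vecMulVec (grad u x) (grad u x) * Matrix.vecMulVec (grad u x) (grad u x) =
      (w u x ^ 2 - 1) • Matrix.vecMulVec (grad u x) (grad u x) := by
    rw [Matrix.vecMulVec_mul_vecMulVec, grad_dotProduct_grad]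
    ext i j; simp [Matrix.vecMulVec_apply]; ring
  rw [firstForm, sub_mul, one_mul, smul_mul_assoc, mul_add, mul_one, hvv, smul_add, smul_smul,
    show (w u x ^ 2)⁻¹ * (w u x ^ 2 - 1) = 1 - (w u x ^ 2)⁻¹ by field_simp]
  module

lemma posSemidef_firstForm (u : EuclideanSpace ℝ (Fin n) → ℝ) (x : EuclideanSpace ℝ (Fin n)) :
    (firstForm u x).PosSemidef := by
  refine Matrix.PosSemidef.one.add ?_
  simpa using Matrix.posSemidef_vecMulVec_self_star (grad u x)

lemma trace_mul_nonneg {A B : Matrix (Fin n) (Fin n) ℝ} (hA : A.PosSemidef) (hB : B.PosSemidef) :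
    0 ≤ (A * B).trace := by
  obtain ⟨C, rfl⟩ : ∃ C : Matrix (Fin n) (Fin n) ℝ, A = C.conjTranspose * C := by
    open scoped MatrixOrder in
    exact CStarAlgebra.nonneg_iff_eq_star_mul_self.mp hA.nonneg
  -- Cyclicity turns the trace of `Cᴴ C B` into that of the positive semidefinite matrix `C B Cᴴ`.
  rw [Matrix.mul_assoc, Matrix.trace_mul_comm]
  exact (hB.mul_mul_conjTranspose_same C).trace_nonneg

/-- An upper bound on the Hessian bounds the mean curvature, whatever the gradient. -/
lemma trace_weingarten_le {u : EuclideanSpace ℝ (Fin n) → ℝ} {x : EuclideanSpace ℝ (Fin n)}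
    {ε : ℝ} (hε : 0 ≤ ε)
    (h : (ε • (1 : Matrix (Fin n) (Fin n) ℝ) - hess u x).PosSemidef) :
    (weingarten u x).trace ≤ (w u x)⁻¹ * (ε * n) := by
  have hw := w_pos u x
  have h1 := trace_mul_nonneg (posSemidef_firstForm u x).inv h
  rw [mul_sub, Matrix.trace_sub, mul_smul_comm, mul_one, Matrix.trace_smul, smul_eq_mul] at h1
  -- The trace equals `n - |Du|² / w²`.
  have h2 : ((firstForm u x)⁻¹).trace ≤ n := by
    rw [firstForm_inv, Matrix.trace_sub, Matrix.trace_one, Fintype.card_fin, Matrix.trace_smul,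
      Matrix.trace_vecMulVec]
    have : 0 ≤ (w u x ^ 2)⁻¹ • (grad u x ⬝ᵥ grad u x) :=
      mul_nonneg (by positivity) (Finset.sum_nonneg fun i _ => mul_self_nonneg _)
    linarith
  rw [weingarten, secondForm, mul_smul_comm, Matrix.trace_smul, smul_eq_mul]
  have := mul_le_mul_of_nonneg_left h2 hε
  exact mul_le_mul_of_nonneg_left (by linarith) (by positivity)

/-! ### One-sided Hessian bounds by touching from above -/

lemma hess_eq_fderiv_fderiv {u : EuclideanSpace ℝ (Fin n) → ℝ} (hu : ContDiff ℝ 2 u)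
    (x : EuclideanSpace ℝ (Fin n)) (i j : Fin n) : hess u x i j =
      fderiv ℝ (fderiv ℝ u) x (EuclideanSpace.single j 1) (EuclideanSpace.single i 1) := by
  have hd : DifferentiableAt ℝ (fderiv ℝ u) x :=
    ((hu.fderiv_right (m := 1) (by norm_num)).differentiable (by norm_num)) x
  simp only [hess, pd, Matrix.of_apply]
  rw [show pd i u = fun y =>
    (fderiv ℝ u y) ((fun _ => EuclideanSpace.single i (1 : ℝ)) y) from rfl,
    fderiv_clm_apply hd (differentiableAt_const _)]
  simp

lemma dotProduct_hess_mulVec {u : EuclideanSpace ℝ (Fin n) → ℝ} (hu : ContDiff ℝ 2 u)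
    (x v : EuclideanSpace ℝ (Fin n)) :
    v.ofLp ⬝ᵥ (hess u x).mulVec v.ofLp = fderiv ℝ (fderiv ℝ u) x v v := by
  have hv : v = ∑ i, v i • EuclideanSpace.single i (1 : ℝ) := by
    ext j; simp [Finset.sum_apply, Pi.single_apply]
  conv_rhs => rw [hv]
  simp only [map_sum, map_smul, sum_apply, smul_apply,
    ← hess_eq_fderiv_fderiv hu, dotProduct, Matrix.mulVec, smul_eq_mul, Finset.mul_sum]
  exact Finset.sum_congr rfl fun i _ => Finset.sum_congr rfl fun j _ => by ring

/-- The terms in `a` and `b` are the restriction of a touching paraboloid to the line. -/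
lemma deriv_deriv_line {u : EuclideanSpace ℝ (Fin n) → ℝ} (hu : ContDiff ℝ 2 u)
    (x v : EuclideanSpace ℝ (Fin n)) (a b : ℝ) :
    deriv (deriv fun t : ℝ => u (x + t • v) - t * a - b * t ^ 2) 0 =
      fderiv ℝ (fderiv ℝ u) x v v - 2 * b := by
  have hline : ∀ t : ℝ, HasDerivAt (fun t : ℝ => x + t • v) v t := fun t => by
    simpa using ((hasDerivAt_id t).smul_const v).const_add x
  have h1 : (deriv fun t : ℝ => u (x + t • v) - t * a - b * t ^ 2) =
      fun t => fderiv ℝ u (x + t • v) v - a - b * (2 * t) := by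
    ext t
    have hd : HasDerivAt (fun t : ℝ => u (x + t • v)) (fderiv ℝ u (x + t • v) v) t :=
      (hu.differentiable (by norm_num) (x + t • v)).hasFDerivAt.comp_hasDerivAt t (hline t)
    have h : HasDerivAt (fun t : ℝ => u (x + t • v) - t * a - b * t ^ 2)
        (fderiv ℝ u (x + t • v) v - 1 * a - b * (((2 : ℕ) : ℝ) * t ^ (2 - 1))) t :=
      (hd.sub ((hasDerivAt_id t).mul_const a)).sub ((hasDerivAt_pow 2 t).const_mul b)
    rw [h.deriv]
    norm_num
  rw [h1]
  have hd : DifferentiableAt ℝ (fderiv ℝ u) (x + (0 : ℝ) • v) :=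
    ((hu.fderiv_right (m := 1) (by norm_num)).differentiable (by norm_num)) _
  have h2 : HasDerivAt (fun t : ℝ => fderiv ℝ u (x + t • v))
      (fderiv ℝ (fderiv ℝ u) (x + (0 : ℝ) • v) v) 0 :=
    hd.hasFDerivAt.comp_hasDerivAt 0 (hline 0)
  have h3 : HasDerivAt (fun t : ℝ => fderiv ℝ u (x + t • v) v)
      (fderiv ℝ (fderiv ℝ u) (x + (0 : ℝ) • v) v v) 0 := by
    simpa using h2.clm_apply (hasDerivAt_const (0 : ℝ) v)
  have h4 : HasDerivAt (fun t : ℝ => fderiv ℝ u (x + t • v) v - a - b * (2 * t))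
      (fderiv ℝ (fderiv ℝ u) (x + (0 : ℝ) • v) v v - b * (2 * 1)) 0 :=
    (h3.sub_const a).sub (((hasDerivAt_id (0 : ℝ)).const_mul 2).const_mul b)
  rw [h4.deriv, zero_smul, add_zero]
  ring

/-- A paraboloid of opening `ε` touching the graph of `u` from above bounds the Hessian. -/
lemma posSemidef_of_touching {u : EuclideanSpace ℝ (Fin n) → ℝ} (hu : ContDiff ℝ 2 u) {ε : ℝ}
    {x p : EuclideanSpace ℝ (Fin n)}
    (h : ∀ v, u (x + v) ≤ u x + inner ℝ p v + ε / 2 * ‖v‖ ^ 2) :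
    (ε • (1 : Matrix (Fin n) (Fin n) ℝ) - hess u x).PosSemidef := by
  refine .of_dotProduct_mulVec_nonneg ?_ fun y => ?_
  · refine (Matrix.isHermitian_one.smul (by simp [IsSelfAdjoint])).sub ?_
    ext i j
    simp [hess_symm hu x j i]
  · set v : EuclideanSpace ℝ (Fin n) := WithLp.toLp 2 y with hv
    -- Touching from above, restricted to the line through `x` in direction `v`, is a maximum at `t
    -- = 0`.
    have hmax : IsLocalMax (fun t : ℝ =>
        u (x + t • v) - t * inner ℝ p v - ε / 2 * ‖v‖ ^ 2 * t ^ 2) 0 := by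
      refine Eventually.of_forall fun t => ?_
      have := h (t • v)
      rw [inner_smul_right, norm_smul, mul_pow, Real.norm_eq_abs, sq_abs] at this
      simp only [zero_smul, add_zero]
      nlinarith
    have hc : Continuous fun t : ℝ =>
        u (x + t • v) - t * inner ℝ p v - ε / 2 * ‖v‖ ^ 2 * t ^ 2 := by
      have := hu.continuous
      fun_prop
    have h2 := hmax.deriv_deriv_nonpos hc.continuousAt
    rw [deriv_deriv_line hu, ← dotProduct_hess_mulVec hu, EuclideanSpace.real_norm_sq_eq] at h2
    rw [Matrix.sub_mulVec, dotProduct_sub, Matrix.smul_mulVec, Matrix.one_mulVec, dotProduct_smul]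
    have : star y ⬝ᵥ y = ∑ i, v i ^ 2 := by simp [dotProduct, hv, pow_two]
    rw [this, star_trivial, smul_eq_mul]
    simp only [hv] at h2 ⊢
    linarith

/-- The hyperboloid `√(1 + |x|²)` lies below its osculating paraboloids of opening `1`. -/
lemma sqrt_one_add_norm_sq_add_le {E : Type*} [NormedAddCommGroup E] [InnerProductSpace ℝ E]
    (x v : E) : √(1 + ‖x + v‖ ^ 2) ≤
      √(1 + ‖x‖ ^ 2) + inner ℝ ((√(1 + ‖x‖ ^ 2))⁻¹ • x) v + 1 / 2 * ‖v‖ ^ 2 := by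
  set s := √(1 + ‖x‖ ^ 2) with hs
  have hsq : s ^ 2 = 1 + ‖x‖ ^ 2 := Real.sq_sqrt (by positivity)
  have h1 : 1 ≤ s := Real.one_le_sqrt.mpr (by nlinarith [sq_nonneg ‖x‖])
  have hr : √(1 + ‖x + v‖ ^ 2) ^ 2 = s ^ 2 + 2 * inner ℝ x v + ‖v‖ ^ 2 := by
    rw [Real.sq_sqrt (by positivity), norm_add_sq_real, hsq]; ring
  set r := √(1 + ‖x + v‖ ^ 2)
  -- This is `2 s r ≤ s² + r²` divided by `2 s`; the opening `s⁻¹` is at most `1`.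
  have h2 : r ≤ s + s⁻¹ * inner ℝ x v + s⁻¹ / 2 * ‖v‖ ^ 2 := by
    refine le_of_mul_le_mul_left ?_ (show 0 < 2 * s by linarith)
    have : 2 * s * (s + s⁻¹ * inner ℝ x v + s⁻¹ / 2 * ‖v‖ ^ 2) =
        2 * s ^ 2 + 2 * inner ℝ x v + ‖v‖ ^ 2 := by
      have : s ≠ 0 := by positivity
      field_simp
    nlinarith [sq_nonneg (r - s)]
  rw [real_inner_smul_left]
  have h3 : s⁻¹ ≤ 1 := inv_le_one_of_one_le₀ h1
  nlinarith [mul_le_mul_of_nonneg_right h3 (sq_nonneg ‖v‖)]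

/-- A `C²` function of sublinear growth has, for every `ε > 0`, a point where `D²u ≤ ε`. -/
lemma exists_hess_le {u : EuclideanSpace ℝ (Fin n) → ℝ} (hu : ContDiff ℝ 2 u)
    (ho : u =o[cobounded (EuclideanSpace ℝ (Fin n))] (fun x => ‖x‖)) {ε : ℝ} (hε : 0 < ε) :
    ∃ x, (ε • (1 : Matrix (Fin n) (Fin n) ℝ) - hess u x).PosSemidef := by
  have hcont : Continuous fun x => u x - ε * √(1 + ‖x‖ ^ 2) := by
    have := hu.continuous
    fun_prop
  have hlim : ∀ᶠ x in cocompact (EuclideanSpace ℝ (Fin n)),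
      u x - ε * √(1 + ‖x‖ ^ 2) ≤ u 0 - ε * √(1 + ‖(0 : EuclideanSpace ℝ (Fin n))‖ ^ 2) := by
    rw [← Metric.cobounded_eq_cocompact]
    -- Far out, `u ≤ (ε / 2) |x|`, so the difference is at most `-(ε / 2) |x|`. The threshold on
    -- `|x|` brings this below `u 0 - ε`, the value at the origin.
    filter_upwards [ho.bound (half_pos hε),
      tendsto_norm_cobounded_atTop.eventually_ge_atTop (2 / ε * (ε - u 0))] with x h1 h2
    have h3 : ‖x‖ ≤ √(1 + ‖x‖ ^ 2) := Real.le_sqrt_of_sq_le (by linarith)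
    have h4 : u x ≤ ε / 2 * ‖x‖ := by
      simpa using (le_abs_self _).trans h1
    have h5 : ε / 2 * (2 / ε * (ε - u 0)) ≤ ε / 2 * ‖x‖ :=
      mul_le_mul_of_nonneg_left h2 (by positivity)
    rw [show ε / 2 * (2 / ε * (ε - u 0)) = ε - u 0 by field_simp] at h5
    have h6 := mul_le_mul_of_nonneg_left h3 hε.le
    simp only [norm_zero, ne_eq, OfNat.ofNat_ne_zero, not_false_eq_true, zero_pow, add_zero,
      Real.sqrt_one, mul_one]
    linarith
  obtain ⟨x, hx⟩ := hcont.exists_forall_ge' 0 hlim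
  -- The slope `p` is the gradient of `ε √(1 + |x|²)` at the maximum point: the hyperboloid, shifted
  -- vertically, touches `u` from above, and its paraboloid lies higher still.
  refine ⟨x, posSemidef_of_touching hu (p := ε • (√(1 + ‖x‖ ^ 2))⁻¹ • x) fun v => ?_⟩
  have h1 := hx (x + v)
  have h2 := mul_le_mul_of_nonneg_left (sqrt_one_add_norm_sq_add_le x v) hε.le
  rw [real_inner_smul_left]
  linarith

end QkTranslator

theorem theorem3p6 (n k : ℕ) :
    ¬ ∃ u : EuclideanSpace ℝ (Fin n) → ℝ,
      ContDiff ℝ 3 u ∧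
      QkTranslator.IsTranslator k u ∧
      (∀ x, QkTranslator.principalCurvatures u x ∈ QkTranslator.Gam (k + 1)) ∧
      u =o[cobounded (EuclideanSpace ℝ (Fin n))] (fun x => ‖x‖) := by
  rintro ⟨u, hu3, heq, hGam, ho⟩
  have hu : ContDiff ℝ 2 u := hu3.of_le (by norm_num)
  -- Chosen so that `ε n < 1`, including `n = 0`.
  have hε : (0 : ℝ) < 1 / (n + 1) := by positivity
  obtain ⟨x, hx⟩ := QkTranslator.exists_hess_le hu ho hε
  have hw := QkTranslator.w_pos u x
  have hQ := QkTranslator.Q_le_sum fun i h1 hi => hGam x i h1 (Nat.le_succ_of_le hi)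
  rw [heq x, QkTranslator.sum_principalCurvatures hu, one_div] at hQ
  have hlt : (1 : ℝ) / (n + 1) * n < 1 := by
    rw [one_div_mul_eq_div, div_lt_one (by positivity)]
    linarith
  have h := hQ.trans (QkTranslator.trace_weingarten_le hε.le hx)
  -- Here `h` reads `w⁻¹ ≤ w⁻¹ * (ε * n)`.
  exact absurd h (not_le.mpr (mul_lt_of_lt_one_right (inv_pos.mpr hw) hlt))
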